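/- Let $d\in\mathbb{N}$ and let $W:\mathbb{R}^d\to\mathbb{R}$ satisfy: (A) $W$ is continuous, $W(-x)=W(x)$ for all $x$, $W(0)=0$ and $W\in C^1(\mathbb{R}^d\setminus\{0\})$; (B) there is a constant $C>0$ with $W(z)\le C(1+|z|^2)$ for all $z\in\mathbb{R}^d$; (C') there are $\lambda',\lambda''\ge 0$ such that $x\mapsto W(x)+\frac{\lambda''}{2}|x|^2+\lambda'|x|$ is convex on $\mathbb{R}^d$. Let $\mathcal{P}_2(\mathbb{R}^d)$ be the set of Borel probability measures $\mu$ on $\mathbb{R}^d$ with $\int|x|^2\,d\mu(x)<\infty$, let $$\mathcal{W}[\mu]=\frac12\int_{\mathbb{R}^d\times\mathbb{R}^d}W(x-y)\,d\mu(x)\,d\mu(y),$$ and let $W_2$ be the Wasserstein distance, $$W_2^2(\mu,\nu)=\inf_{\gamma\in\Gamma(\mu,\nu)}\int_{\mathbb{R}^d\times\mathbb{R}^d}|x-y|^2\,d\gamma(x,y),$$ where $\Gamma(\mu,\nu)$ is the set of Borel probability measures on $\mathbb{R}^d\times\mathbb{R}^d$ with first marginal $\mu$ and second marginal $\nu$.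 Then $\mathcal{W}[\mu]$ (as an absolutely convergent integral) and $W_2(\mu,\nu)$ are well defined and finite for all $\mu,\nu\in\mathcal{P}_2(\mathbb{R}^d)$, and there exists $\tau_0>0$, depending only on $W$, such that for every $0<\tau<\tau_0$ and every $\bar\mu\in\mathcal{P}_2(\mathbb{R}^d)$ there is $\mu_\infty\in\mathcal{P}_2(\mathbb{R}^d)$ with $$\mathcal{W}[\mu_\infty]+\frac{1}{2\tau}W_2^2(\mu_\infty,\bar\mu)=\min_{\mu\in\mathcal{P}_2(\mathbb{R}^d)}\Big\{\mathcal{W}[\mu]+\frac{1}{2\tau}W_2^2(\mu,\bar\mu)\Big\}.$$ -/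

import Mathlib

open MeasureTheory
open scoped ENNReal

namespace InteractionEnergy

/-- The Euclidean space `ℝ^d`, with its Euclidean norm and its Borel σ-algebra. -/
abbrev E (d : ℕ) : Type := EuclideanSpace ℝ (Fin d)

/-- Assumptions A, B and C' on an interaction potential `W : ℝ^d → ℝ`. -/
structure IsPotential {d : ℕ} (W : E d → ℝ) : Prop where
  /-- A: continuity. -/
  continuous : Continuous W
  /-- A: symmetry. -/
  even : ∀ x, W (-x) = W x
  /-- A: normalization at the origin. -/
  zero : W 0 = 0
  /-- A: `W` is of class `C¹` on `ℝ^d` without the origin. -/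
  contDiffOn : ContDiffOn ℝ 1 W {0}ᶜ
  /-- B: at most quadratic growth from above. -/
  growth : ∃ C : ℝ, 0 < C ∧ ∀ z, W z ≤ C * (1 + ‖z‖ ^ 2)
  /-- C': convexity up to a quadratic and a linear term. -/
  convex : ∃ l' l'' : ℝ, 0 ≤ l' ∧ 0 ≤ l'' ∧
    ConvexOn ℝ Set.univ (fun x => W x + l'' / 2 * ‖x‖ ^ 2 + l' * ‖x‖)

/-- `P_2(ℝ^d)`: Borel probability measures with finite second moment. -/
def P2 (d : ℕ) : Set (ProbabilityMeasure (E d)) :=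
  {μ | ∫⁻ x, ‖x‖ₑ ^ 2 ∂(μ : Measure (E d)) < ∞}

/-- Transport plans between `μ` and `ν`: probability measures on the product with
marginals `μ` and `ν`. -/
def plans {d : ℕ} (μ ν : ProbabilityMeasure (E d)) : Set (ProbabilityMeasure (E d × E d)) :=
  {γ | (γ : Measure (E d × E d)).map Prod.fst = (μ : Measure (E d)) ∧
    (γ : Measure (E d × E d)).map Prod.snd = (ν : Measure (E d))}

/-- The optimal quadratic transport cost between `μ` and `ν`, with values in `[0, ∞]`. -/
noncomputable def transportCost {d : ℕ} (μ ν : ProbabilityMeasure (E d)) : ℝ≥0∞ :=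
  ⨅ γ ∈ plans μ ν, ∫⁻ p, edist p.1 p.2 ^ 2 ∂(γ : Measure (E d × E d))

/-- The Wasserstein distance `W_2`, the square root of the optimal quadratic cost (which is
finite on `P_2(ℝ^d)`). -/
noncomputable def W2 {d : ℕ} (μ ν : ProbabilityMeasure (E d)) : ℝ :=
  √(transportCost μ ν).toReal

/-- The interaction energy `𝒲[μ] = 1/2 ∫∫ W(x - y) dμ(x) dμ(y)`. -/
noncomputable def energy {d : ℕ} (W : E d → ℝ) (μ : ProbabilityMeasure (E d)) : ℝ :=
  1 / 2 * ∫ p, W (p.1 - p.2) ∂((μ : Measure (E d)).prod (μ : Measure (E d)))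

end InteractionEnergy

namespace InteractionEnergy

open Filter Topology
open scoped NNReal

/-! ### Weak convergence and tightness -/

/-! Weak convergence with bounded second moments does not give lower semicontinuity of the energy,
because `W` may decrease like `-K|z|²`. The transport term compensates when `τ` is small. Both terms
are written as a single integral against `γ ⊗ γ`, where `γ` is a plan with second marginal `μbar`;
adding a quadratic term that sees only `μbar` changes the functional by a constant and makes the
integrand nonnegative for `τ < 1/(8K)` (`le_liftedDensity`). A nonnegative continuous integrand
gives lower semicontinuity, the same bound gives tightness, and Prokhorov's theorem yields a
minimizing plan. Its first marginal is the required measure (`liftedEnergy_eq` translates back). -/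

/-- The integral of a nonnegative continuous function is lower semicontinuous for weak
convergence. -/
lemma lowerSemicontinuous_lintegral {X : Type*} [TopologicalSpace X] [MeasurableSpace X]
    [OpensMeasurableSpace X] {f : X → ℝ≥0} (hf : Continuous f) :
    LowerSemicontinuous (fun μ : ProbabilityMeasure X => ∫⁻ x, f x ∂(μ : Measure X)) := by
  -- The truncations `min f n` are bounded and continuous, so their integrals are weakly continuous;
  -- a supremum of these is lower semicontinuous.
  have key : (fun μ : ProbabilityMeasure X => ∫⁻ x, f x ∂(μ : Measure X)) =
      fun μ : ProbabilityMeasure X =>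
        ⨆ n : ℕ, ∫⁻ x, ((min (f x) (n : ℝ≥0) : ℝ≥0) : ℝ≥0∞) ∂(μ : Measure X) := by
    funext μ
    rw [← lintegral_iSup (fun n => (hf.min continuous_const).measurable.coe_nnreal_ennreal)
      (fun m n hmn x => by
        have : (m : ℝ≥0) ≤ n := by exact_mod_cast hmn
        exact ENNReal.coe_le_coe.2 (min_le_min le_rfl this))]
    refine lintegral_congr fun x => ?_
    refine le_antisymm ?_ (iSup_le fun n => ENNReal.coe_le_coe.2 (min_le_left _ _))
    obtain ⟨n, hn⟩ := exists_nat_ge (f x)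
    exact le_iSup_of_le n (by rw [min_eq_left hn])
  rw [key]
  refine lowerSemicontinuous_iSup fun n => Continuous.lowerSemicontinuous ?_
  let g : BoundedContinuousFunction X ℝ≥0 :=
    BoundedContinuousFunction.mkOfBound ⟨fun x => min (f x) n, hf.min continuous_const⟩ n
      (fun x y => by
        have hx : ((min (f x) n : ℝ≥0) : ℝ) ≤ n := by exact_mod_cast min_le_right (f x) (n : ℝ≥0)
        have hy : ((min (f y) n : ℝ≥0) : ℝ) ≤ n := by exact_mod_cast min_le_right (f y) (n : ℝ≥0)
        have hx0 := (min (f x) n : ℝ≥0).coe_nonneg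
        have hy0 := (min (f y) n : ℝ≥0).coe_nonneg
        rw [NNReal.dist_eq, abs_le]
        exact ⟨by simp only [ContinuousMap.coe_mk]; linarith,
          by simp only [ContinuousMap.coe_mk]; linarith⟩)
  exact ProbabilityMeasure.continuous_iff_forall_continuous_lintegral.1 continuous_id g

/-- Uniformly bounded second moments imply tightness. -/
lemma isTightMeasureSet_of_lintegral_sq_le {F : Type*} [NormedAddCommGroup F] [ProperSpace F]
    [MeasurableSpace F] [OpensMeasurableSpace F] {S : Set (Measure F)} {M : ℝ≥0∞} (hM : M ≠ ∞)
    (h : ∀ μ ∈ S, ∫⁻ x, ‖x‖ₑ ^ 2 ∂μ ≤ M) : IsTightMeasureSet S := by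
  refine isTightMeasureSet_of_tendsto_measure_norm_gt ?_
  have hlim : Tendsto (fun r : ℝ => M / ENNReal.ofReal r ^ 2) atTop (𝓝 0) := by
    have h2 : Tendsto (fun r : ℝ => ENNReal.ofReal r ^ 2) atTop (𝓝 ∞) := by
      simpa using! ((ENNReal.continuous_pow 2).tendsto ∞).comp ENNReal.tendsto_ofReal_atTop
    simpa using ENNReal.Tendsto.const_div h2 (Or.inr hM)
  refine tendsto_of_tendsto_of_tendsto_of_le_of_le' tendsto_const_nhds hlim
    (Eventually.of_forall fun _ => zero_le) ?_
  filter_upwards [eventually_gt_atTop 0] with r hr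
  refine iSup₂_le fun μ hμ => ?_
  have hr' : ENNReal.ofReal r ^ 2 ≠ 0 := by simpa using hr
  calc μ {x | r < ‖x‖} ≤ μ {x | ENNReal.ofReal r ^ 2 ≤ ‖x‖ₑ ^ 2} := by
        refine measure_mono fun x hx => ?_
        have : r < ‖x‖ := hx
        show ENNReal.ofReal r ^ 2 ≤ ‖x‖ₑ ^ 2
        gcongr
        rw [← ofReal_norm]
        exact ENNReal.ofReal_le_ofReal this.le
    _ ≤ (∫⁻ x, ‖x‖ₑ ^ 2 ∂μ) / ENNReal.ofReal r ^ 2 :=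
        meas_ge_le_lintegral_div (by fun_prop) hr' (by finiteness)
    _ ≤ M / ENNReal.ofReal r ^ 2 := by gcongr; exact h μ hμ

/-! ### Second moments -/

lemma enorm_sq_eq_ofReal {F : Type*} [NormedAddCommGroup F] (x : F) :
    ‖x‖ₑ ^ 2 = ENNReal.ofReal (‖x‖ ^ 2) := by
  rw [ENNReal.ofReal_pow (norm_nonneg _), ofReal_norm]

lemma norm_add_sq_le {F : Type*} [NormedAddCommGroup F] (x y : F) :
    ‖x + y‖ ^ 2 ≤ 2 * (‖x‖ ^ 2 + ‖y‖ ^ 2) :=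
  (pow_le_pow_left₀ (norm_nonneg _) (norm_add_le x y) 2).trans add_sq_le

lemma enorm_prod_sq_le {F : Type*} [NormedAddCommGroup F] (p : F × F) :
    ‖p‖ₑ ^ 2 ≤ 2 * (‖p.1 - p.2‖ₑ ^ 2 + ‖p.2‖ₑ ^ 2) := by
  simp only [enorm_sq_eq_ofReal]
  rw [← ENNReal.ofReal_add (by positivity) (by positivity), ← ENNReal.ofReal_ofNat,
    ← ENNReal.ofReal_mul (by norm_num)]
  refine ENNReal.ofReal_le_ofReal ?_
  have h1 : ‖p.1‖ ^ 2 ≤ 2 * (‖p.1 - p.2‖ ^ 2 + ‖p.2‖ ^ 2) := by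
    simpa using norm_add_sq_le (p.1 - p.2) p.2
  rw [Prod.norm_def]
  rcases max_choice ‖p.1‖ ‖p.2‖ with h | h <;> rw [h]
  · exact h1
  · nlinarith [sq_nonneg ‖p.1 - p.2‖, sq_nonneg ‖p.2‖]

lemma integrable_norm_sq_iff {X F : Type*} [MeasurableSpace X] [NormedAddCommGroup F]
    {μ : Measure X} {f : X → F} (hf : AEStronglyMeasurable f μ) :
    Integrable (fun x => ‖f x‖ ^ 2) μ ↔ ∫⁻ x, ‖f x‖ₑ ^ 2 ∂μ < ∞ := by
  have h : AEStronglyMeasurable (fun x => ‖f x‖ ^ 2) μ := hf.norm.pow 2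
  simp [Integrable, h, HasFiniteIntegral]

lemma toReal_lintegral_enorm_sq {X F : Type*} [MeasurableSpace X] [NormedAddCommGroup F]
    {μ : Measure X} {f : X → F} (hf : AEStronglyMeasurable f μ) :
    (∫⁻ x, ‖f x‖ₑ ^ 2 ∂μ).toReal = ∫ x, ‖f x‖ ^ 2 ∂μ := by
  rw [integral_eq_lintegral_of_nonneg_ae (Eventually.of_forall fun x => by positivity)
    (show AEStronglyMeasurable (fun x => ‖f x‖ ^ 2) μ from hf.norm.pow 2)]
  simp only [enorm_sq_eq_ofReal]

variable {d : ℕ}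

lemma mem_P2_iff {μ : ProbabilityMeasure (E d)} :
    μ ∈ P2 d ↔ Integrable (fun x => ‖x‖ ^ 2) (μ : Measure (E d)) :=
  (integrable_norm_sq_iff aestronglyMeasurable_id).symm

/-- The cost of a transport plan. -/
noncomputable def planCost (γ : ProbabilityMeasure (E d × E d)) : ℝ≥0∞ :=
  ∫⁻ p, ‖p.1 - p.2‖ₑ ^ 2 ∂(γ : Measure (E d × E d))

lemma transportCost_eq (μ ν : ProbabilityMeasure (E d)) :
    transportCost μ ν = ⨅ γ ∈ plans μ ν, planCost γ := by
  simp only [transportCost, planCost, edist_eq_enorm_sub]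

lemma planCost_lt_top_iff {γ : ProbabilityMeasure (E d × E d)} :
    planCost γ < ∞ ↔
      Integrable (fun p : E d × E d => ‖p.1 - p.2‖ ^ 2) (γ : Measure (E d × E d)) :=
  (integrable_norm_sq_iff (by fun_prop)).symm

lemma toReal_planCost (γ : ProbabilityMeasure (E d × E d)) :
    (planCost γ).toReal = ∫ p, ‖p.1 - p.2‖ ^ 2 ∂(γ : Measure (E d × E d)) :=
  toReal_lintegral_enorm_sq (by fun_prop)

lemma integrable_norm_sub_sq {μ ν : Measure (E d)} [IsProbabilityMeasure μ]
    [IsProbabilityMeasure ν] (hμ : Integrable (fun x => ‖x‖ ^ 2) μ)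
    (hν : Integrable (fun x => ‖x‖ ^ 2) ν) :
    Integrable (fun p : E d × E d => ‖p.1 - p.2‖ ^ 2) (μ.prod ν) := by
  refine Integrable.mono' (((hμ.comp_fst ν).add (hν.comp_snd μ)).const_mul 2) (by fun_prop)
    (Eventually.of_forall fun p => ?_)
  have h := norm_add_sq_le p.1 (-p.2)
  rw [norm_neg, ← sub_eq_add_neg] at h
  rw [Real.norm_of_nonneg (by positivity)]
  exact h

lemma prod_mem_plans (μ ν : ProbabilityMeasure (E d)) : μ.prod ν ∈ plans μ ν := by
  constructor <;> simp [Measure.map_fst_prod, Measure.map_snd_prod]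

lemma planCost_prod_lt_top {μ ν : ProbabilityMeasure (E d)} (hμ : μ ∈ P2 d) (hν : ν ∈ P2 d) :
    planCost (μ.prod ν) < ∞ :=
  planCost_lt_top_iff.2 (integrable_norm_sub_sq (mem_P2_iff.1 hμ) (mem_P2_iff.1 hν))

lemma transportCost_le_planCost {μ ν : ProbabilityMeasure (E d)}
    {γ : ProbabilityMeasure (E d × E d)} (hγ : γ ∈ plans μ ν) :
    transportCost μ ν ≤ planCost γ := by
  rw [transportCost_eq]
  exact iInf₂_le γ hγ

lemma transportCost_lt_top {μ ν : ProbabilityMeasure (E d)} (hμ : μ ∈ P2 d) (hν : ν ∈ P2 d) :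
    transportCost μ ν < ∞ :=
  (transportCost_le_planCost (prod_mem_plans μ ν)).trans_lt (planCost_prod_lt_top hμ hν)

lemma lintegral_enorm_sq_plan_le {μ ν : ProbabilityMeasure (E d)}
    {γ : ProbabilityMeasure (E d × E d)} (hγ : γ ∈ plans μ ν) :
    ∫⁻ p, ‖p‖ₑ ^ 2 ∂(γ : Measure (E d × E d)) ≤
      2 * (planCost γ + ∫⁻ y, ‖y‖ₑ ^ 2 ∂(ν : Measure (E d))) := by
  rw [planCost, ← hγ.2, lintegral_map (by fun_prop) measurable_snd,
    ← lintegral_add_left (by fun_prop), ← lintegral_const_mul _ (by fun_prop)]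
  exact lintegral_mono fun p => enorm_prod_sq_le p

/-- A measure at finite cost from one with finite second moment has finite second moment. -/
lemma mem_P2_of_planCost_lt_top {μ ν : ProbabilityMeasure (E d)}
    {γ : ProbabilityMeasure (E d × E d)} (hγ : γ ∈ plans μ ν) (hν : ν ∈ P2 d)
    (hc : planCost γ < ∞) : μ ∈ P2 d := by
  have hν' : ∫⁻ y, ‖y‖ₑ ^ 2 ∂(ν : Measure (E d)) < ∞ := hν
  show ∫⁻ x, ‖x‖ₑ ^ 2 ∂(μ : Measure (E d)) < ∞
  rw [← hγ.1, lintegral_map (by fun_prop) measurable_fst]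
  refine lt_of_le_of_lt (lintegral_mono fun p => ?_)
    ((lintegral_enorm_sq_plan_le hγ).trans_lt
      (ENNReal.mul_lt_top (by simp) (ENNReal.add_lt_top.2 ⟨hc, hν'⟩)))
  gcongr
  rw [← ofReal_norm, ← ofReal_norm]
  exact ENNReal.ofReal_le_ofReal (norm_fst_le p)

/-! ### The potential -/

/-- A potential is bounded by a quadratic function: from above by assumption, and from below
since an even convex function is minimal at the origin. -/
lemma IsPotential.exists_abs_le {W : E d → ℝ} (hW : IsPotential W) :
    ∃ K : ℝ, 0 < K ∧ ∀ z, |W z| ≤ K * (1 + ‖z‖ ^ 2) := by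
  obtain ⟨C, hC, hup⟩ := hW.growth
  obtain ⟨l', l'', hl', hl'', hconv⟩ := hW.convex
  refine ⟨C + l' + l'', by positivity, fun z => abs_le.2 ⟨?_, ?_⟩⟩
  -- The origin is the midpoint of `z` and `-z`, so convexity and evenness give `0 ≤ W z + l''/2
  -- |z|² + l' |z|`.
  · have h := hconv.2 (Set.mem_univ z) (Set.mem_univ (-z)) (by norm_num : (0 : ℝ) ≤ 1 / 2)
      (by norm_num : (0 : ℝ) ≤ 1 / 2) (by norm_num)
    simp only [smul_neg, add_neg_cancel, hW.zero, hW.even, norm_neg, norm_zero, smul_eq_mul] at h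
    have h1 : ‖z‖ ≤ 1 + ‖z‖ ^ 2 := by nlinarith [sq_nonneg (‖z‖ - 1)]
    nlinarith [mul_le_mul_of_nonneg_left h1 hl', mul_nonneg hl'' (sq_nonneg ‖z‖),
      mul_nonneg hC.le (sq_nonneg ‖z‖)]
  · nlinarith [hup z, mul_nonneg (add_nonneg hl' hl'') (sq_nonneg ‖z‖)]

lemma integrable_potential {W : E d → ℝ} (hW : IsPotential W) {μ : ProbabilityMeasure (E d)}
    (hμ : μ ∈ P2 d) :
    Integrable (fun p : E d × E d => W (p.1 - p.2))
      ((μ : Measure (E d)).prod (μ : Measure (E d))) := by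
  obtain ⟨K, hK, hb⟩ := hW.exists_abs_le
  have h2 := integrable_norm_sub_sq (mem_P2_iff.1 hμ) (mem_P2_iff.1 hμ)
  refine Integrable.mono' (((integrable_const 1).add h2).const_mul K) ?_
    (Eventually.of_forall fun p => hb _)
  exact (hW.continuous.comp (continuous_fst.sub continuous_snd)).aestronglyMeasurable

/-! ### The functional on plans -/

/-- The integrand of the lifted functional: energy plus transport cost, doubled in the variables,
plus a quadratic term in the second marginal that makes it nonnegative. -/
noncomputable def liftedDensity (W : E d → ℝ) (τ K : ℝ) (r : (E d × E d) × (E d × E d)) : ℝ :=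
  1 / 2 * W (r.1.1 - r.2.1) + 1 / (4 * τ) * (‖r.1.1 - r.1.2‖ ^ 2 + ‖r.2.1 - r.2.2‖ ^ 2) +
    K / 2 * (1 + 3 * ‖r.1.2 - r.2.2‖ ^ 2)

/-- The energy plus transport cost of a plan, up to an additive constant depending only on the
second marginal. -/
noncomputable def liftedEnergy (W : E d → ℝ) (τ K : ℝ) (γ : ProbabilityMeasure (E d × E d)) :
    ℝ≥0∞ :=
  ∫⁻ r, ((liftedDensity W τ K r).toNNReal : ℝ≥0∞)
    ∂(γ.prod γ : Measure ((E d × E d) × (E d × E d)))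

lemma continuous_liftedDensity {W : E d → ℝ} (hW : Continuous W) (τ K : ℝ) :
    Continuous (liftedDensity W τ K) := by
  unfold liftedDensity
  fun_prop

lemma lowerSemicontinuous_liftedEnergy {W : E d → ℝ} (hW : Continuous W) (τ K : ℝ) :
    LowerSemicontinuous (liftedEnergy W τ K) := by
  have h := lowerSemicontinuous_lintegral
    (continuous_real_toNNReal.comp (continuous_liftedDensity hW τ K))
  have hp : Continuous fun γ : ProbabilityMeasure (E d × E d) => γ.prod γ :=
    ProbabilityMeasure.continuous_prod.comp (continuous_id.prodMk continuous_id)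
  exact h.comp hp

/-- Splitting `x - x'` through `y` and `y'`, the bound `-K/2 (1 + |x - x'|²)` costs at most `3K/2`
times each of `|x - y|²`, `|x' - y'|²`, `|y - y'|²`, plus `K/2`. The added term absorbs the constant
and `|y - y'|²`; `1/(4τ) ≥ 2K` absorbs the others and leaves `K/2`. -/
lemma le_liftedDensity {W : E d → ℝ} {τ K : ℝ} (hK : 0 < K) (hτ : 0 < τ) (hτK : τ < 1 / (8 * K))
    (hb : ∀ z, |W z| ≤ K * (1 + ‖z‖ ^ 2)) (r : (E d × E d) × (E d × E d)) :
    K / 2 * ‖r.1.1 - r.1.2‖ ^ 2 ≤ liftedDensity W τ K r := by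
  obtain ⟨⟨x, y⟩, ⟨x', y'⟩⟩ := r
  simp only [liftedDensity]
  have h4 : 2 * K ≤ 1 / (4 * τ) := by
    rw [le_div_iff₀ (by positivity)]
    rw [lt_div_iff₀ (by positivity)] at hτK
    linarith
  have htri : ‖x - x'‖ ≤ ‖x - y‖ + ‖x' - y'‖ + ‖y - y'‖ := by
    have : x - x' = (x - y) + -(x' - y') + (y - y') := by abel
    rw [this, ← norm_neg (x' - y')]
    exact norm_add₃_le
  have hsq : ‖x - x'‖ ^ 2 ≤ 3 * (‖x - y‖ ^ 2 + ‖x' - y'‖ ^ 2 + ‖y - y'‖ ^ 2) := by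
    refine (pow_le_pow_left₀ (norm_nonneg _) htri 2).trans ?_
    nlinarith [sq_nonneg (‖x - y‖ - ‖x' - y'‖), sq_nonneg (‖x - y‖ - ‖y - y'‖),
      sq_nonneg (‖x' - y'‖ - ‖y - y'‖)]
  have hlow := (abs_le.1 (hb (x - x'))).1
  have h5 := mul_le_mul_of_nonneg_right h4
    (add_nonneg (sq_nonneg ‖x - y‖) (sq_nonneg ‖x' - y'‖))
  have h6 := mul_le_mul_of_nonneg_left hsq hK.le
  have h7 := mul_nonneg hK.le (sq_nonneg ‖x' - y'‖)
  linarith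

lemma liftedDensity_nonneg {W : E d → ℝ} {τ K : ℝ} (hK : 0 < K) (hτ : 0 < τ)
    (hτK : τ < 1 / (8 * K)) (hb : ∀ z, |W z| ≤ K * (1 + ‖z‖ ^ 2))
    (r : (E d × E d) × (E d × E d)) : 0 ≤ liftedDensity W τ K r :=
  le_trans (by positivity) (le_liftedDensity hK hτ hτK hb r)

/-- Coercivity: it makes sublevel sets tight and gives the minimizing plan finite cost. -/
lemma planCost_le_liftedEnergy {W : E d → ℝ} {τ K : ℝ} (hK : 0 < K) (hτ : 0 < τ)
    (hτK : τ < 1 / (8 * K)) (hb : ∀ z, |W z| ≤ K * (1 + ‖z‖ ^ 2))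
    (γ : ProbabilityMeasure (E d × E d)) :
    planCost γ ≤ ENNReal.ofReal (2 / K) * liftedEnergy W τ K γ := by
  have h1 : planCost γ = ∫⁻ r, ‖r.1.1 - r.1.2‖ₑ ^ 2
      ∂(γ.prod γ : Measure ((E d × E d) × (E d × E d))) := by
    have hfst : MeasurePreserving Prod.fst
        ((γ : Measure (E d × E d)).prod (γ : Measure (E d × E d))) γ := measurePreserving_fst
    exact (hfst.lintegral_comp (by fun_prop)).symm
  rw [h1, liftedEnergy, ← lintegral_const_mul' _ _ ENNReal.ofReal_ne_top]
  refine lintegral_mono fun r => ?_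
  rw [enorm_sq_eq_ofReal]
  change _ ≤ ENNReal.ofReal (2 / K) * ENNReal.ofReal _
  rw [← ENNReal.ofReal_mul (by positivity)]
  refine ENNReal.ofReal_le_ofReal ?_
  have h := mul_le_mul_of_nonneg_left (le_liftedDensity hK hτ hτK hb r)
    (by positivity : 0 ≤ 2 / K)
  have h2 : 2 / K * (K / 2 * ‖r.1.1 - r.1.2‖ ^ 2) = ‖r.1.1 - r.1.2‖ ^ 2 := by field_simp
  rwa [h2] at h

/-- The additive constant in the lifted functional. -/
noncomputable def liftedConst (K : ℝ) (ν : ProbabilityMeasure (E d)) : ℝ :=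
  ∫ q, K / 2 * (1 + 3 * ‖q.1 - q.2‖ ^ 2) ∂((ν : Measure (E d)).prod (ν : Measure (E d)))

/-- Pairs of first (second) coordinates push `γ ⊗ γ` to `μ ⊗ μ` (`ν ⊗ ν`). The cost occurs twice
with weight `1/(4τ)`, hence `1/(2τ)`. -/
lemma integrable_and_integral_liftedDensity {W : E d → ℝ} (hW : IsPotential W) (τ K : ℝ)
    {μ ν : ProbabilityMeasure (E d)} (hν : ν ∈ P2 d) {γ : ProbabilityMeasure (E d × E d)}
    (hγ : γ ∈ plans μ ν) (hc : planCost γ < ∞) :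
    Integrable (liftedDensity W τ K) (γ.prod γ : Measure ((E d × E d) × (E d × E d))) ∧
    ∫ r, liftedDensity W τ K r ∂(γ.prod γ : Measure ((E d × E d) × (E d × E d))) =
      energy W μ + 1 / (2 * τ) * (planCost γ).toReal + liftedConst K ν := by
  have hμ := mem_P2_of_planCost_lt_top hγ hν hc
  have hf : MeasurePreserving Prod.fst (γ : Measure (E d × E d)) μ := ⟨measurable_fst, hγ.1⟩
  have hs : MeasurePreserving Prod.snd (γ : Measure (E d × E d)) ν := ⟨measurable_snd, hγ.2⟩
  have hff := hf.prod hf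
  have hss := hs.prod hs
  have hcI := planCost_lt_top_iff.1 hc
  have hWI := integrable_potential hW hμ
  have hνI : Integrable (fun q : E d × E d => K / 2 * (1 + 3 * ‖q.1 - q.2‖ ^ 2))
      ((ν : Measure (E d)).prod (ν : Measure (E d))) :=
    ((integrable_const 1).add
      ((integrable_norm_sub_sq (mem_P2_iff.1 hν) (mem_P2_iff.1 hν)).const_mul 3)).const_mul _
  have i1 : Integrable (fun r : (E d × E d) × (E d × E d) => 1 / 2 * W (r.1.1 - r.2.1))
      ((γ : Measure (E d × E d)).prod (γ : Measure (E d × E d))) :=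
    (hff.integrable_comp_of_integrable hWI).const_mul _
  have ia : Integrable (fun r : (E d × E d) × (E d × E d) => ‖r.1.1 - r.1.2‖ ^ 2)
      ((γ : Measure (E d × E d)).prod (γ : Measure (E d × E d))) := hcI.comp_fst _
  have ib : Integrable (fun r : (E d × E d) × (E d × E d) => ‖r.2.1 - r.2.2‖ ^ 2)
      ((γ : Measure (E d × E d)).prod (γ : Measure (E d × E d))) := hcI.comp_snd _
  have i2 : Integrable (fun r : (E d × E d) × (E d × E d) =>
      1 / (4 * τ) * (‖r.1.1 - r.1.2‖ ^ 2 + ‖r.2.1 - r.2.2‖ ^ 2))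
      ((γ : Measure (E d × E d)).prod (γ : Measure (E d × E d))) := (ia.add ib).const_mul _
  have i3 : Integrable (fun r : (E d × E d) × (E d × E d) =>
      K / 2 * (1 + 3 * ‖r.1.2 - r.2.2‖ ^ 2))
      ((γ : Measure (E d × E d)).prod (γ : Measure (E d × E d))) :=
    hss.integrable_comp_of_integrable hνI
  refine ⟨(i1.add i2).add i3, ?_⟩
  have e1 : ∫ r : (E d × E d) × (E d × E d), 1 / 2 * W (r.1.1 - r.2.1)
      ∂((γ : Measure (E d × E d)).prod (γ : Measure (E d × E d))) = energy W μ := by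
    rw [integral_const_mul, energy, ← hff.map_eq, integral_map hff.aemeasurable]
    · rfl
    · rw [hff.map_eq]; exact hWI.aestronglyMeasurable
  have e3 : ∫ r : (E d × E d) × (E d × E d), K / 2 * (1 + 3 * ‖r.1.2 - r.2.2‖ ^ 2)
      ∂((γ : Measure (E d × E d)).prod (γ : Measure (E d × E d))) = liftedConst K ν := by
    rw [liftedConst, ← hss.map_eq, integral_map hss.aemeasurable]
    · rfl
    · rw [hss.map_eq]; exact hνI.aestronglyMeasurable
  have e2 : ∫ r : (E d × E d) × (E d × E d),
      1 / (4 * τ) * (‖r.1.1 - r.1.2‖ ^ 2 + ‖r.2.1 - r.2.2‖ ^ 2)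
      ∂((γ : Measure (E d × E d)).prod (γ : Measure (E d × E d))) =
      1 / (2 * τ) * (planCost γ).toReal := by
    rw [integral_const_mul, integral_add ia ib, toReal_planCost,
      integral_fun_fst (fun p : E d × E d => ‖p.1 - p.2‖ ^ 2),
      integral_fun_snd (fun p : E d × E d => ‖p.1 - p.2‖ ^ 2)]
    simp only [probReal_univ, one_smul]
    ring
  rw [← e1, ← e2, ← e3, ← integral_add i1 i2]
  exact integral_add (i1.add i2) i3

lemma liftedEnergy_eq {W : E d → ℝ} (hW : IsPotential W) {τ K : ℝ} (hK : 0 < K) (hτ : 0 < τ)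
    (hτK : τ < 1 / (8 * K)) (hb : ∀ z, |W z| ≤ K * (1 + ‖z‖ ^ 2))
    {μ ν : ProbabilityMeasure (E d)} (hν : ν ∈ P2 d) {γ : ProbabilityMeasure (E d × E d)}
    (hγ : γ ∈ plans μ ν) (hc : planCost γ < ∞) :
    liftedEnergy W τ K γ < ∞ ∧ (liftedEnergy W τ K γ).toReal =
      energy W μ + 1 / (2 * τ) * (planCost γ).toReal + liftedConst K ν := by
  obtain ⟨hI, he⟩ := integrable_and_integral_liftedDensity hW τ K hν hγ hc
  have hnn := liftedDensity_nonneg hK hτ hτK hb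
  have h : liftedEnergy W τ K γ = ENNReal.ofReal (∫ r, liftedDensity W τ K r
      ∂(γ.prod γ : Measure ((E d × E d) × (E d × E d)))) :=
    (ofReal_integral_eq_lintegral_ofReal hI (Eventually.of_forall hnn)).symm
  refine ⟨h ▸ ENNReal.ofReal_lt_top, ?_⟩
  rw [h, ENNReal.toReal_ofReal (integral_nonneg hnn), he]

lemma mem_plans_map_fst {ν : ProbabilityMeasure (E d)} {γ : ProbabilityMeasure (E d × E d)}
    (h : γ.map measurable_snd.aemeasurable = ν) :
    γ ∈ plans (γ.map measurable_fst.aemeasurable) ν := by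
  subst h
  exact ⟨rfl, rfl⟩

/-- The lifted functional has a minimizer among the plans with given second marginal. -/
lemma exists_minimizer_liftedEnergy {W : E d → ℝ} (hW : IsPotential W) {τ K : ℝ} (hK : 0 < K)
    (hτ : 0 < τ) (hτK : τ < 1 / (8 * K)) (hb : ∀ z, |W z| ≤ K * (1 + ‖z‖ ^ 2))
    {ν : ProbabilityMeasure (E d)} (hν : ν ∈ P2 d) :
    ∃ μ, ∃ γ ∈ plans μ ν, liftedEnergy W τ K γ < ∞ ∧
      ∀ μ', ∀ γ' ∈ plans μ' ν, liftedEnergy W τ K γ ≤ liftedEnergy W τ K γ' := by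
  have hlsc := lowerSemicontinuous_liftedEnergy hW.continuous τ K
  let γ₀ := ν.prod ν
  have hγ₀ : liftedEnergy W τ K γ₀ < ∞ :=
    (liftedEnergy_eq hW hK hτ hτK hb hν (prod_mem_plans ν ν) (planCost_prod_lt_top hν hν)).1
  let S : Set (ProbabilityMeasure (E d × E d)) :=
    {γ | γ.map measurable_snd.aemeasurable = ν} ∩
      liftedEnergy W τ K ⁻¹' Set.Iic (liftedEnergy W τ K γ₀)
  have hclosed : IsClosed S :=
    (isClosed_eq (ProbabilityMeasure.continuous_map continuous_snd) continuous_const).inter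
      (hlsc.isClosed_preimage _)
  have hmap : ∀ {μ' : ProbabilityMeasure (E d)} {γ : ProbabilityMeasure (E d × E d)},
      γ ∈ plans μ' ν → γ.map measurable_snd.aemeasurable = ν := fun h => Subtype.ext h.2
  have htight : IsTightMeasureSet {((γ : ProbabilityMeasure (E d × E d)) : Measure (E d × E d)) |
      γ ∈ S} := by
    refine isTightMeasureSet_of_lintegral_sq_le (M := 2 * (ENNReal.ofReal (2 / K) *
      liftedEnergy W τ K γ₀ + ∫⁻ y, ‖y‖ₑ ^ 2 ∂(ν : Measure (E d)))) ?_ ?_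
    · exact (ENNReal.mul_lt_top (by simp)
        (ENNReal.add_lt_top.2 ⟨ENNReal.mul_lt_top ENNReal.ofReal_lt_top hγ₀, hν⟩)).ne
    · rintro _ ⟨γ, ⟨hγ1, hγ2⟩, rfl⟩
      refine (lintegral_enorm_sq_plan_le (mem_plans_map_fst hγ1)).trans ?_
      gcongr
      refine (planCost_le_liftedEnergy hK hτ hτK hb γ).trans ?_
      gcongr
      exact hγ2
  have hcomp : IsCompact S := by
    simpa only [hclosed.closure_eq] using isCompact_closure_of_isTightMeasureSet htight
  have hmem : γ₀ ∈ S := ⟨hmap (prod_mem_plans ν ν), le_refl (liftedEnergy W τ K γ₀)⟩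
  obtain ⟨γ, hγS, hmin⟩ := (hlsc.lowerSemicontinuousOn S).exists_isMinOn ⟨γ₀, hmem⟩ hcomp
  refine ⟨_, γ, mem_plans_map_fst hγS.1, lt_of_le_of_lt hγS.2 hγ₀, fun μ' γ' hγ' => ?_⟩
  by_cases h : liftedEnergy W τ K γ' ≤ liftedEnergy W τ K γ₀
  · exact hmin ⟨hmap hγ', h⟩
  -- Plans outside `S` already lose to `γ₀`.
  · exact le_trans hγS.2 (not_le.1 h).le

lemma W2_sq (μ ν : ProbabilityMeasure (E d)) : W2 μ ν ^ 2 = (transportCost μ ν).toReal :=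
  Real.sq_sqrt ENNReal.toReal_nonneg

end InteractionEnergy
open InteractionEnergy in
/-- The first two conjuncts say that both terms of the functional are well defined and finite
on `P_2(ℝ^d)`, so that no default value of an integral or of `toReal` enters the third. -/
theorem mainTheorem6 (d : ℕ) (W : E d → ℝ) (hW : IsPotential W) :
    (∀ μ ∈ P2 d, Integrable (fun p : E d × E d => W (p.1 - p.2))
      ((μ : Measure (E d)).prod (μ : Measure (E d)))) ∧
    (∀ μ ∈ P2 d, ∀ ν ∈ P2 d, transportCost μ ν < ∞) ∧
    ∃ τ₀ : ℝ, 0 < τ₀ ∧ ∀ τ : ℝ, 0 < τ → τ < τ₀ → ∀ μbar ∈ P2 d,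
      ∃ μinf ∈ P2 d,
        IsMinOn (fun μ => energy W μ + 1 / (2 * τ) * W2 μ μbar ^ 2) (P2 d) μinf := by
  refine ⟨fun μ hμ => integrable_potential hW hμ,
    fun μ hμ ν hν => transportCost_lt_top hμ hν, ?_⟩
  obtain ⟨K, hK, hb⟩ := hW.exists_abs_le
  refine ⟨1 / (8 * K), by positivity, fun τ hτ hτK ν hν => ?_⟩
  obtain ⟨μ₀, γ₀, hγ₀, hfin, hmin⟩ := exists_minimizer_liftedEnergy hW hK hτ hτK hb hν
  have hc₀ : planCost γ₀ < ∞ := (planCost_le_liftedEnergy hK hτ hτK hb γ₀).trans_lt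
    (ENNReal.mul_lt_top ENNReal.ofReal_lt_top hfin)
  have hμ₀ := mem_P2_of_planCost_lt_top hγ₀ hν hc₀
  refine ⟨μ₀, hμ₀, fun μ hμ => ?_⟩
  show energy W μ₀ + 1 / (2 * τ) * W2 μ₀ ν ^ 2 ≤ energy W μ + 1 / (2 * τ) * W2 μ ν ^ 2
  rw [W2_sq, W2_sq]
  -- Minimality of `γ₀` is rearranged into a lower bound independent of `γ`, so that the infimum
  -- over plans can be taken without an optimal plan. Truncation by `ENNReal.ofReal` is harmless,
  -- costs being nonnegative.
  have hplan : ∀ γ ∈ plans μ ν,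
      ENNReal.ofReal (2 * τ * (energy W μ₀ - energy W μ) + (planCost γ₀).toReal) ≤
        planCost γ := by
    intro γ hγ
    rcases eq_or_ne (planCost γ) ∞ with h | h
    · simp [h]
    have e := liftedEnergy_eq hW hK hτ hτK hb hν hγ h.lt_top
    have hle := ENNReal.toReal_mono e.1.ne (hmin μ γ hγ)
    rw [e.2, (liftedEnergy_eq hW hK hτ hτK hb hν hγ₀ hc₀).2] at hle
    refine ENNReal.ofReal_le_of_le_toReal ?_
    have h3 := mul_le_mul_of_nonneg_left hle (by positivity : 0 ≤ 2 * τ)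
    field_simp at h3
    linarith
  have hinf := (ENNReal.ofReal_le_iff_le_toReal (transportCost_lt_top hμ hν).ne).1
    ((le_iInf₂ hplan).trans_eq (transportCost_eq μ ν).symm)
  -- For `μ₀` only this inequality is needed: `γ₀` need not be known to be optimal.
  have hle₀ := ENNReal.toReal_mono hc₀.ne (transportCost_le_planCost hγ₀)
  have h4 := mul_le_mul_of_nonneg_left (hinf.trans' (add_le_add_right hle₀ _))
    (by positivity : 0 ≤ 1 / (2 * τ))
  rw [mul_add, ← mul_assoc, one_div_mul_cancel (by positivity), one_mul] at h4
  linarith
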